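/- For complex $a,c$ with $c\notin\{0,-1,-2,\dots\}$, let ${}_1F_1(a;c;z)=\sum_{n=0}^{\infty}\frac{(a)_n}{(c)_n\,n!}z^n$ denote the confluent hypergeometric function, where $(x)_n=x(x+1)\cdots(x+n-1)$ and $(x)_0=1$. The Hermite–Biehler class is the set of all entire functions $E$ that have no zeros in the upper half-plane $\{z\in\mathbb{C}:\operatorname{Im} z>0\}$ and satisfy $|E(z)|\ge|E(\bar z)|$ whenever $\operatorname{Im} z>0$. Let $\gamma>-1/2$ and $\tau\in\mathbb{R}$. Then the function $$z\mapsto {}_1F_1(\gamma+i\tau;\,2\gamma+1;\,iz)\,e^{-iz/2}$$ is entire and belongs to the Hermite–Biehler class. -/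

import Mathlib

/-- The confluent hypergeometric function
`₁F₁(a; c; z) = ∑ₙ (a)ₙ / ((c)ₙ n!) zⁿ`, with `(x)ₙ = x (x + 1) ⋯ (x + n - 1)`.
The parameter `c` is meant not to be a nonpositive integer; the series then converges
for every `z`. -/
noncomputable def confluentHypergeometric (a c z : ℂ) : ℂ :=
  ∑' n : ℕ, (ascPochhammer ℂ n).eval a / ((ascPochhammer ℂ n).eval c * (n.factorial : ℂ)) * z ^ n

/-- The Hermite–Biehler class: entire functions `E` without zeros in the open upper half-plane
that satisfy `|E(z)| ≥ |E(z̄)|` there. -/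
structure IsHermiteBiehler (E : ℂ → ℂ) : Prop where
  entire : Differentiable ℂ E
  ne_zero : ∀ z : ℂ, 0 < z.im → E z ≠ 0
  norm_conj_le : ∀ z : ℂ, 0 < z.im → ‖E (starRingEnd ℂ z)‖ ≤ ‖E z‖

/-!
Write `M(a) = ₁F₁(a; c; ·)` and `a = γ + iτ`, `c = 2γ + 1`, so that `c - a - 1 = ā`. Kummer's
transformation `M(c - b)(x) = eˣ M(b)(-x)` shows that `E^#(z) = conj (E(z̄))` is the function
`M(a + 1)(iz) e^{-iz/2}`, so both `|E(z̄)| ≤ |E(z)|` and `E(z) ≠ 0` follow from the strict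
inequality `|M(a + 1)(x)| < |M(a)(x)|` for `Re x < 0`
(`norm_confluentHypergeometric_add_one_lt`).

The pair `M(a)`, `M(a + 1)` satisfies a first-order system, read off from the coefficients:
`x M(a)' = a (M(a + 1) - M(a))` and `x M(a + 1)' = (c - a - 1) (M(a) - M(a + 1)) + x M(a + 1)`.
Along the ray `t ↦ t x`, put `U(t) = M(a)(tx) e^{-tx/2}` and `V(t) = M(a + 1)(tx) e^{-tx/2}`. Then
`t U' = a (V - U) - (tx/2) U` and `t V' = ā (U - V) + (tx/2) V`. The cross terms in the derivatives
of `|U|²` and `|V|²` agree, being real parts of conjugate numbers, and what is left is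
`d/dt [t^{2γ} (|U|² - |V|²)] = -Re x · t^{2γ} (|U|² + |V|²)`.
The bracket tends to `0` as `t → 0⁺`, because `U(0) = V(0) = 1` gives `|U|² - |V|² = O(t)` and
`2γ + 1 > 0`. Hence it is positive for `t > 0` (`norm_lt_norm_of_system`).
-/

open Filter Topology

/-! ### Coefficients of the confluent hypergeometric series -/

/-- The coefficient of `zⁿ` in `₁F₁(a; c; z)`. -/
noncomputable def confluentCoeff (a c : ℂ) (n : ℕ) : ℂ :=
  (ascPochhammer ℂ n).eval a / ((ascPochhammer ℂ n).eval c * (n.factorial : ℂ))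

theorem ascPochhammer_eval_ne_zero_of_forall {c : ℂ} (hc : ∀ n : ℕ, c + n ≠ 0) (n : ℕ) :
    (ascPochhammer ℂ n).eval c ≠ 0 := by
  induction n with
  | zero => simp
  | succ n ih => rw [ascPochhammer_succ_eval]; exact mul_ne_zero ih (hc n)

theorem ascPochhammer_succ_eval_left (a : ℂ) (n : ℕ) :
    (ascPochhammer ℂ (n + 1)).eval a = a * (ascPochhammer ℂ n).eval (a + 1) := by
  simp [ascPochhammer_succ_left]

theorem confluentCoeff_succ_mul {c : ℂ} (hc : ∀ n : ℕ, c + n ≠ 0) (a : ℂ) (n : ℕ) :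
    confluentCoeff a c (n + 1) * ((c + n) * (n + 1)) = (a + n) * confluentCoeff a c n := by
  have h1 := ascPochhammer_eval_ne_zero_of_forall hc n
  have h2 := hc n
  have h3 : (n.factorial : ℂ) ≠ 0 := by exact_mod_cast n.factorial_ne_zero
  have h4 : (n + 1 : ℂ) ≠ 0 := by exact_mod_cast n.succ_ne_zero
  simp only [confluentCoeff, ascPochhammer_succ_eval, Nat.factorial_succ]
  push_cast
  field_simp

/-- Coefficient form of `z M(a)' = a (M(a + 1) - M(a))`, where `M(a) = ₁F₁(a; c; ·)`. -/
theorem natCast_mul_confluentCoeff (a c : ℂ) (n : ℕ) :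
    n * confluentCoeff a c n = a * (confluentCoeff (a + 1) c n - confluentCoeff a c n) := by
  have h := (ascPochhammer_succ_eval_left a n).symm.trans (ascPochhammer_succ_eval n a)
  simp only [confluentCoeff]
  rw [← sub_div, mul_div_assoc', mul_div_assoc']
  congr 1
  linear_combination -h

/-- Coefficient form of `z M(a + 1)' = (c - a - 1) (M(a) - M(a + 1)) + z M(a + 1)`, where
`M(a) = ₁F₁(a; c; ·)`. -/
theorem succ_mul_confluentCoeff_add_one {c : ℂ} (hc : ∀ n : ℕ, c + n ≠ 0) (a : ℂ) (n : ℕ) :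
    ((n + 1 : ℕ) : ℂ) * confluentCoeff (a + 1) c (n + 1) =
      (c - a - 1) * (confluentCoeff a c (n + 1) - confluentCoeff (a + 1) c (n + 1))
        + confluentCoeff (a + 1) c n := by
  have h1 := ascPochhammer_eval_ne_zero_of_forall hc n
  have h2 := hc n
  have h3 : (n.factorial : ℂ) ≠ 0 := by exact_mod_cast n.factorial_ne_zero
  have h4 : (n + 1 : ℂ) ≠ 0 := by exact_mod_cast n.succ_ne_zero
  simp only [confluentCoeff, ascPochhammer_succ_eval_left a, Nat.factorial_succ,
    ascPochhammer_succ_eval n (a + 1), ascPochhammer_succ_eval n c]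
  push_cast
  field_simp
  ring

/-! ### The confluent hypergeometric function as an entire function -/

theorem summable_norm_confluentCoeff_mul_pow {c : ℂ} (hc : ∀ n : ℕ, c + n ≠ 0) (a z : ℂ) :
    Summable fun n : ℕ => ‖confluentCoeff a c n * z ^ n‖ := by
  -- The ratio of consecutive terms is at most `(‖a‖ + 1) ‖z‖ / ‖c + n‖`, which tends to `0`.
  have hden : Tendsto (fun n : ℕ => ‖c + n‖) atTop atTop := by
    refine tendsto_atTop_mono (f := fun n : ℕ => -‖c‖ + (n : ℝ)) (fun n => ?_)
      (tendsto_atTop_add_const_left _ _ tendsto_natCast_atTop_atTop)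
    have := norm_sub_norm_le (n : ℂ) (-c)
    rw [sub_neg_eq_add, norm_neg, Complex.norm_natCast, add_comm (n : ℂ)] at this
    linarith
  have hbig := hden.eventually_ge_atTop (2 * ((‖a‖ + 1) * ‖z‖))
  refine summable_of_ratio_norm_eventually_le (r := 1 / 2) (by norm_num) ?_
  filter_upwards [hbig] with n hn
  have h2 : 0 < ‖c + n‖ := norm_pos_iff.2 (hc n)
  have key := congrArg norm (confluentCoeff_succ_mul hc a n)
  have h4 : ‖(n + 1 : ℂ)‖ = n + 1 := by exact_mod_cast Complex.norm_natCast (n + 1)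
  rw [norm_mul, norm_mul, norm_mul, h4] at key
  have ha : ‖a + n‖ ≤ (‖a‖ + 1) * (n + 1) := by
    have := norm_add_le a (n : ℂ)
    rw [Complex.norm_natCast] at this
    nlinarith [norm_nonneg a, Nat.cast_nonneg (α := ℝ) n]
  have h5 : ‖confluentCoeff a c (n + 1)‖ * ‖c + n‖ ≤ (‖a‖ + 1) * ‖confluentCoeff a c n‖ := by
    have hn1 : (0 : ℝ) < n + 1 := by positivity
    refine le_of_mul_le_mul_right ?_ hn1
    calc _ = ‖a + n‖ * ‖confluentCoeff a c n‖ := by rw [← key]; ring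
      _ ≤ (‖a‖ + 1) * (n + 1) * ‖confluentCoeff a c n‖ := by gcongr
      _ = _ := by ring
  simp only [norm_norm, norm_mul, norm_pow, pow_succ]
  refine le_of_mul_le_mul_right ?_ h2
  calc ‖confluentCoeff a c (n + 1)‖ * (‖z‖ ^ n * ‖z‖) * ‖c + n‖
      = (‖confluentCoeff a c (n + 1)‖ * ‖c + n‖) * (‖z‖ ^ n * ‖z‖) := by ring
    _ ≤ ((‖a‖ + 1) * ‖confluentCoeff a c n‖) * (‖z‖ ^ n * ‖z‖) := by gcongr
    _ = 1 / 2 * (‖confluentCoeff a c n‖ * ‖z‖ ^ n) * (2 * ((‖a‖ + 1) * ‖z‖)) := by ring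
    _ ≤ 1 / 2 * (‖confluentCoeff a c n‖ * ‖z‖ ^ n) * ‖c + n‖ := by gcongr

theorem hasSum_confluentHypergeometric {c : ℂ} (hc : ∀ n : ℕ, c + n ≠ 0) (a z : ℂ) :
    HasSum (fun n : ℕ => confluentCoeff a c n * z ^ n) (confluentHypergeometric a c z) :=
  (summable_norm_confluentCoeff_mul_pow hc a z).of_norm.hasSum

theorem confluentHypergeometric_zero (a c : ℂ) : confluentHypergeometric a c 0 = 1 := by
  rw [confluentHypergeometric, tsum_eq_single 0 (fun n hn => by simp [hn])]
  simp

theorem norm_confluentCoeff_mul_pow_le {a c z : ℂ} {r : ℝ} (hz : z ∈ Metric.ball (0 : ℂ) r)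
    (n : ℕ) : ‖confluentCoeff a c n * z ^ n‖ ≤ ‖confluentCoeff a c n * (r : ℂ) ^ n‖ := by
  have hz' : ‖z‖ < r := by simpa using hz
  rw [norm_mul, norm_mul, norm_pow, norm_pow, Complex.norm_real, Real.norm_eq_abs]
  gcongr
  exact hz'.le.trans (le_abs_self r)

theorem differentiable_confluentHypergeometric {c : ℂ} (hc : ∀ n : ℕ, c + n ≠ 0) (a : ℂ) :
    Differentiable ℂ (confluentHypergeometric a c) := by
  intro z
  have hz : z ∈ Metric.ball (0 : ℂ) (‖z‖ + 1) := by simp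
  refine (Complex.differentiableOn_tsum_of_summable_norm
    (F := fun (n : ℕ) z => confluentCoeff a c n * z ^ n)
    (summable_norm_confluentCoeff_mul_pow hc a (‖z‖ + 1 : ℝ)) (fun n => by fun_prop)
    Metric.isOpen_ball fun n w hw => norm_confluentCoeff_mul_pow_le hw n).differentiableAt
    (Metric.isOpen_ball.mem_nhds hz)

theorem hasSum_mul_deriv_confluentHypergeometric {c : ℂ} (hc : ∀ n : ℕ, c + n ≠ 0) (a z : ℂ) :
    HasSum (fun n : ℕ => n * confluentCoeff a c n * z ^ n)
      (z * deriv (confluentHypergeometric a c) z) := by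
  have hz : z ∈ Metric.ball (0 : ℂ) (‖z‖ + 1) := by simp
  have h := Complex.hasSum_deriv_of_summable_norm
    (F := fun (n : ℕ) z => confluentCoeff a c n * z ^ n)
    (summable_norm_confluentCoeff_mul_pow hc a (‖z‖ + 1 : ℝ)) (fun n => by fun_prop)
    Metric.isOpen_ball (fun n w hw => norm_confluentCoeff_mul_pow_le hw n) hz
  refine (h.mul_left z).congr_fun ?_
  intro n
  cases n with
  | zero => simp
  | succ n =>
    rw [deriv_const_mul_field, deriv_pow_field, Nat.add_sub_cancel, pow_succ]
    ring

theorem mul_deriv_confluentHypergeometric {c : ℂ} (hc : ∀ n : ℕ, c + n ≠ 0) (a z : ℂ) :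
    z * deriv (confluentHypergeometric a c) z =
      a * (confluentHypergeometric (a + 1) c z - confluentHypergeometric a c z) := by
  refine (hasSum_mul_deriv_confluentHypergeometric hc a z).unique ?_
  refine (((hasSum_confluentHypergeometric hc (a + 1) z).sub
    (hasSum_confluentHypergeometric hc a z)).mul_left a).congr_fun fun n => ?_
  rw [natCast_mul_confluentCoeff]
  ring

theorem mul_deriv_confluentHypergeometric_add_one {c : ℂ} (hc : ∀ n : ℕ, c + n ≠ 0) (a z : ℂ) :
    z * deriv (confluentHypergeometric (a + 1) c) z =
      (c - a - 1) * (confluentHypergeometric a c z - confluentHypergeometric (a + 1) c z)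
        + z * confluentHypergeometric (a + 1) c z := by
  have h1 := ((hasSum_confluentHypergeometric hc a z).sub
    (hasSum_confluentHypergeometric hc (a + 1) z)).mul_left (c - a - 1)
  have h2 := hasSum_mul_deriv_confluentHypergeometric hc (a + 1) z
  -- The terms of index `0` cancel; the rest is the series of `z * M(a + 1)` shifted by one.
  have h3 := h2.sub h1
  rw [← hasSum_nat_add_iff' 1] at h3
  have h4 := h3.unique (((hasSum_confluentHypergeometric hc (a + 1) z).mul_left z).congr_fun
    fun n => by
      rw [succ_mul_confluentCoeff_add_one hc]
      ring)
  simp [confluentCoeff] at h4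
  linear_combination h4

/-! ### Kummer's transformation and complex conjugation -/

/-- The Chu–Vandermonde identity, with the Pochhammer symbols of `c` cleared
from the denominators. -/
theorem sum_antidiagonal_choose_mul_ascPochhammer (n : ℕ) (b c : ℂ) :
    ∑ kl ∈ Finset.HasAntidiagonal.antidiagonal n, (n.choose kl.1 : ℂ) * ((-1) ^ kl.1 *
      (ascPochhammer ℂ kl.1).eval b * (ascPochhammer ℂ kl.2).eval (c + kl.1)) =
      (ascPochhammer ℂ n).eval (c - b) := by
  induction n generalizing b c with
  | zero => simp
  | succ n ih =>
    rw [Finset.sum_antidiagonal_choose_succ_mul (fun k l => (-1 : ℂ) ^ k *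
      (ascPochhammer ℂ k).eval b * (ascPochhammer ℂ l).eval (c + k)) n]
    have h1 : ∑ kl ∈ Finset.HasAntidiagonal.antidiagonal n, (n.choose kl.1 : ℂ) *
        ((-1 : ℂ) ^ kl.1 *
        (ascPochhammer ℂ kl.1).eval b * (ascPochhammer ℂ (kl.2 + 1)).eval (c + kl.1)) =
        (c + n) * (ascPochhammer ℂ n).eval (c - b) := by
      rw [← ih b c, Finset.mul_sum]
      refine Finset.sum_congr rfl fun kl hkl => ?_
      have hn : (kl.1 : ℂ) + kl.2 = n := by
        exact_mod_cast Finset.HasAntidiagonal.mem_antidiagonal.1 hkl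
      rw [ascPochhammer_succ_eval, ← hn]
      ring
    have h2 : ∑ kl ∈ Finset.HasAntidiagonal.antidiagonal n, (n.choose kl.2 : ℂ) *
        ((-1 : ℂ) ^ (kl.1 + 1) *
        (ascPochhammer ℂ (kl.1 + 1)).eval b * (ascPochhammer ℂ kl.2).eval (c + (kl.1 + 1 : ℕ))) =
        -b * (ascPochhammer ℂ n).eval (c - b) := by
      rw [← add_sub_add_right_eq_sub c b 1, ← ih (b + 1) (c + 1), Finset.mul_sum]
      refine Finset.sum_congr rfl fun kl hkl => ?_
      rw [ascPochhammer_succ_eval_left,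
        ← Nat.choose_symm_of_eq_add (Finset.HasAntidiagonal.mem_antidiagonal.1 hkl).symm]
      push_cast
      rw [add_right_comm c, ← add_assoc, pow_succ]
      ring
    rw [h1, h2, ascPochhammer_succ_eval]
    ring

theorem ascPochhammer_eval_add (k l : ℕ) (c : ℂ) :
    (ascPochhammer ℂ (k + l)).eval c =
      (ascPochhammer ℂ k).eval c * (ascPochhammer ℂ l).eval (c + k) := by
  rw [← ascPochhammer_mul]
  simp

/-- Kummer's transformation. Comparing coefficients in the Cauchy product of the two series on the
right, it is the Chu–Vandermonde identity. -/
theorem confluentHypergeometric_sub_eq_exp_mul {c : ℂ} (hc : ∀ n : ℕ, c + n ≠ 0) (b x : ℂ) :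
    confluentHypergeometric (c - b) c x =
      confluentHypergeometric b c (-x) * Complex.exp x := by
  have hexp : HasSum (fun n : ℕ => x ^ n / (n.factorial : ℂ)) (Complex.exp x) := by
    rw [Complex.exp_eq_exp_ℂ]
    exact NormedSpace.expSeries_div_hasSum_exp x
  rw [← hexp.tsum_eq, ← (hasSum_confluentHypergeometric hc b (-x)).tsum_eq,
    tsum_mul_tsum_eq_tsum_sum_antidiagonal_of_summable_norm
      (summable_norm_confluentCoeff_mul_pow hc b (-x)) (NormedSpace.norm_expSeries_div_summable x),
    ← (hasSum_confluentHypergeometric hc (c - b) x).tsum_eq]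
  refine tsum_congr fun n => ?_
  rw [confluentCoeff, ← sum_antidiagonal_choose_mul_ascPochhammer, Finset.sum_div, Finset.sum_mul]
  refine Finset.sum_congr rfl fun kl hkl => ?_
  obtain ⟨k, l⟩ := kl
  obtain rfl : k + l = n := Finset.HasAntidiagonal.mem_antidiagonal.1 hkl
  have h1 := ascPochhammer_eval_ne_zero_of_forall hc k
  have h2 := ascPochhammer_eval_ne_zero_of_forall hc (k + l)
  rw [ascPochhammer_eval_add] at h2
  have h3 := right_ne_zero_of_mul h2
  have h4 : ((k + l).factorial : ℂ) = (k + l).choose k * k.factorial * l.factorial := by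
    rw [Nat.choose_symm_add]
    exact_mod_cast (Nat.add_choose_mul_factorial_mul_factorial k l).symm
  have h5 : ((k + l).choose k : ℂ) ≠ 0 := by
    exact_mod_cast (Nat.choose_pos (Nat.le_add_right k l)).ne'
  have h6 : (k.factorial : ℂ) ≠ 0 := by exact_mod_cast k.factorial_ne_zero
  have h7 : (l.factorial : ℂ) ≠ 0 := by exact_mod_cast l.factorial_ne_zero
  simp only [confluentCoeff]
  rw [ascPochhammer_eval_add, h4, neg_pow x, pow_add]
  field_simp

theorem conj_ascPochhammer_eval (n : ℕ) (a : ℂ) :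
    starRingEnd ℂ ((ascPochhammer ℂ n).eval a) = (ascPochhammer ℂ n).eval (starRingEnd ℂ a) := by
  induction n with
  | zero => simp
  | succ n ih => simp [ascPochhammer_succ_eval, ih]

theorem conj_confluentHypergeometric (a c z : ℂ) :
    starRingEnd ℂ (confluentHypergeometric a c z) =
      confluentHypergeometric (starRingEnd ℂ a) (starRingEnd ℂ c) (starRingEnd ℂ z) := by
  simp [confluentHypergeometric, Complex.conj_tsum, conj_ascPochhammer_eval]

/-! ### Monotonicity along rays -/

/-- The energy identity for the system `t U' = a (V - U) + t w U`, `t V' = ā (U - V) - t w V`: the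
factor `t ^ (2 Re a)` absorbs the term `-2 Re a (‖U‖² - ‖V‖²)` of
`t d/dt (‖U‖² - ‖V‖²)`. -/
theorem hasDerivAt_rpow_mul_norm_sq_sub {a w : ℂ} {U V : ℝ → ℂ} {U' V' : ℂ} {t : ℝ} (ht : 0 < t)
    (hU : HasDerivAt U U' t) (hV : HasDerivAt V V' t)
    (hUeq : t * U' = a * (V t - U t) + t * w * U t)
    (hVeq : t * V' = starRingEnd ℂ a * (U t - V t) - t * w * V t) :
    HasDerivAt (fun s : ℝ => s ^ (2 * a.re) * (‖U s‖ ^ 2 - ‖V s‖ ^ 2))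
      (t ^ (2 * a.re) * (2 * w.re * (‖U t‖ ^ 2 + ‖V t‖ ^ 2))) t := by
  have hD := (Real.hasDerivAt_rpow_const (p := 2 * a.re) (Or.inl ht.ne')).mul
    (hU.norm_sq.sub hV.norm_sq)
  refine hD.congr_deriv ?_
  have hpow : t ^ (2 * a.re) = t ^ (2 * a.re - 1) * t := by
    rw [← Real.rpow_add_one ht.ne', sub_add_cancel]
  have key : t * (2 * inner ℝ (U t) U' - 2 * inner ℝ (V t) V') =
      -(2 * a.re) * (‖U t‖ ^ 2 - ‖V t‖ ^ 2) + t * (2 * w.re * (‖U t‖ ^ 2 + ‖V t‖ ^ 2)) := by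
    have h1 := congrArg Complex.re hUeq
    have h2 := congrArg Complex.im hUeq
    have h3 := congrArg Complex.re hVeq
    have h4 := congrArg Complex.im hVeq
    simp only [Complex.mul_re, Complex.mul_im, Complex.add_re, Complex.add_im, Complex.sub_re,
      Complex.sub_im, Complex.conj_re, Complex.conj_im, Complex.ofReal_re, Complex.ofReal_im]
      at h1 h2 h3 h4
    simp only [Complex.inner, Complex.sq_norm, Complex.normSq_apply, Complex.mul_re,
      Complex.conj_re, Complex.conj_im]
    linear_combination 2 * (U t).re * h1 + 2 * (U t).im * h2 - 2 * (V t).re * h3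
      - 2 * (V t).im * h4
  simp only [Pi.sub_apply]
  rw [hpow]
  linear_combination t ^ (2 * a.re - 1) * key

theorem tendsto_rpow_mul_norm_sq_sub {p : ℝ} (hp : -1 < p) {U V : ℝ → ℂ}
    (hU : DifferentiableAt ℝ U 0) (hV : DifferentiableAt ℝ V 0) (h0 : ‖U 0‖ = ‖V 0‖) :
    Tendsto (fun s : ℝ => s ^ p * (‖U s‖ ^ 2 - ‖V s‖ ^ 2)) (𝓝[>] 0) (𝓝 0) := by
  have hD := (hU.hasDerivAt.norm_sq.sub hV.hasDerivAt.norm_sq).tendsto_slope_zero_right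
  have hpow : Tendsto (fun s : ℝ => s ^ (p + 1)) (𝓝[>] 0) (𝓝 0) := by
    have h := (Real.continuousAt_rpow_const 0 (p + 1) (Or.inr (by linarith))).tendsto
    rw [Real.zero_rpow (by linarith)] at h
    exact h.mono_left nhdsWithin_le_nhds
  have h := hpow.mul hD
  rw [zero_mul] at h
  refine h.congr' ?_
  filter_upwards [self_mem_nhdsWithin] with s hs
  have hs' : s ≠ 0 := (Set.mem_Ioi.1 hs).ne'
  simp only [Pi.sub_apply, zero_add, h0, sub_self, sub_zero, smul_eq_mul]
  rw [Real.rpow_add_one hs']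
  field_simp

/-- The quantity `t ^ (2 Re a) (‖U‖² - ‖V‖²)` increases from its limit `0` at `0⁺`, strictly near
`0` since `U 0 ≠ 0`. -/
theorem norm_lt_norm_of_system {a w : ℂ} (ha : -1 / 2 < a.re) (hw : 0 < w.re)
    {U V U' V' : ℝ → ℂ} (hU : ∀ t, HasDerivAt U (U' t) t) (hV : ∀ t, HasDerivAt V (V' t) t)
    (hUeq : ∀ t : ℝ, t * U' t = a * (V t - U t) + t * w * U t)
    (hVeq : ∀ t : ℝ, t * V' t = starRingEnd ℂ a * (U t - V t) - t * w * V t)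
    (h0 : ‖U 0‖ = ‖V 0‖) (hU0 : U 0 ≠ 0) {t : ℝ} (ht : 0 < t) : ‖V t‖ < ‖U t‖ := by
  set g : ℝ → ℝ := fun s => s ^ (2 * a.re) * (‖U s‖ ^ 2 - ‖V s‖ ^ 2) with hg
  have hderiv : ∀ s > 0, HasDerivAt g _ s := fun s hs =>
    hasDerivAt_rpow_mul_norm_sq_sub hs (hU s) (hV s) (hUeq s) (hVeq s)
  have hcont : ContinuousOn g (Set.Ioi 0) := fun s hs =>
    (hderiv s hs).continuousAt.continuousWithinAt
  have hmono : MonotoneOn g (Set.Ioi 0) := by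
    refine monotoneOn_of_deriv_nonneg (convex_Ioi 0) hcont ?_ ?_ <;> rw [interior_Ioi]
    · exact fun s hs => (hderiv s hs).differentiableAt.differentiableWithinAt
    · intro s hs
      rw [(hderiv s hs).deriv]
      have : (0 : ℝ) ≤ s := le_of_lt hs
      positivity
  have hlim : Tendsto g (𝓝[>] 0) (𝓝 0) := tendsto_rpow_mul_norm_sq_sub (by linarith)
    (hU 0).differentiableAt (hV 0).differentiableAt h0
  have hnonneg : ∀ s > 0, 0 ≤ g s := by
    intro s hs
    refine le_of_tendsto hlim ?_
    filter_upwards [Ioo_mem_nhdsGT hs] with r hr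
    exact hmono hr.1 hs hr.2.le
  obtain ⟨δ, hδ, hδU⟩ : ∃ δ > 0, ∀ s ∈ Set.Ioo (0 : ℝ) δ, U s ≠ 0 := by
    have h := ((hU 0).continuousAt.eventually_ne hU0).filter_mono
      (nhdsWithin_le_nhds (s := Set.Ioi 0))
    exact (mem_nhdsGT_iff_exists_Ioo_subset).1 h
  have hstrict : StrictMonoOn g (Set.Ioo 0 δ) := by
    refine strictMonoOn_of_deriv_pos (convex_Ioo 0 δ) (hcont.mono Set.Ioo_subset_Ioi_self) ?_
    rw [interior_Ioo]
    intro s hs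
    rw [(hderiv s hs.1).deriv]
    have h1 : 0 < s := hs.1
    have h2 : 0 < ‖U s‖ := norm_pos_iff.2 (hδU s hs)
    positivity
  have hpos : 0 < g t := by
    set r := min t (δ / 2) with hr
    have hr0 : 0 < r := lt_min ht (half_pos hδ)
    have hrδ : r < δ := (min_le_right _ _).trans_lt (half_lt_self hδ)
    calc 0 ≤ g (r / 2) := hnonneg _ (half_pos hr0)
      _ < g r := hstrict ⟨half_pos hr0, (half_lt_self hr0).trans hrδ⟩ ⟨hr0, hrδ⟩
        (half_lt_self hr0)
      _ ≤ g t := hmono hr0 ht (min_le_left _ _)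
  have := pos_of_mul_pos_right hpos (Real.rpow_nonneg ht.le _)
  exact lt_of_pow_lt_pow_left₀ 2 (norm_nonneg _) (sub_pos.1 this)

/-! ### Comparison of contiguous functions in the left half-plane -/

theorem hasDerivAt_confluentHypergeometric_mul_exp {c : ℂ} (hc : ∀ n : ℕ, c + n ≠ 0)
    (a x : ℂ) (t : ℝ) :
    HasDerivAt (fun s : ℝ => confluentHypergeometric a c (s * x) * Complex.exp (-(s * x) / 2))
      ((x * deriv (confluentHypergeometric a c) (t * x)
        - x / 2 * confluentHypergeometric a c (t * x)) * Complex.exp (-(t * x) / 2)) t := by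
  have hlin : HasDerivAt (fun s : ℂ => s * x) x (t : ℂ) := by
    simpa using (hasDerivAt_id (t : ℂ)).mul_const x
  have hM := ((differentiable_confluentHypergeometric hc a (t * x)).hasDerivAt).comp (t : ℂ) hlin
  have hE := ((hlin.neg.div_const 2).cexp)
  refine ((hM.mul hE).comp_ofReal).congr_deriv ?_
  simp only [Function.comp_apply, Pi.neg_apply]
  ring

theorem norm_confluentHypergeometric_add_one_lt {a c x : ℂ} (hc : ∀ n : ℕ, c + n ≠ 0)
    (hac : c - a - 1 = starRingEnd ℂ a) (ha : -1 / 2 < a.re) (hx : x.re < 0) :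
    ‖confluentHypergeometric (a + 1) c x‖ < ‖confluentHypergeometric a c x‖ := by
  have h := norm_lt_norm_of_system ha (w := -x / 2) (by simpa using hx)
    (hasDerivAt_confluentHypergeometric_mul_exp hc a x)
    (hasDerivAt_confluentHypergeometric_mul_exp hc (a + 1) x)
    (fun t => by
      linear_combination Complex.exp (-(t * x) / 2) *
        mul_deriv_confluentHypergeometric hc a (t * x))
    (fun t => by
      rw [← hac]
      linear_combination Complex.exp (-(t * x) / 2) *
        mul_deriv_confluentHypergeometric_add_one hc a (t * x))
    (by simp [confluentHypergeometric_zero]) (by simp [confluentHypergeometric_zero]) one_pos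
  simp only [Complex.ofReal_one, one_mul, norm_mul] at h
  exact lt_of_mul_lt_mul_right h (norm_nonneg _)

/-! ### The Hermite–Biehler property -/

theorem mainTheorem6 (γ τ : ℝ) (hγ : -1 / 2 < γ) :
    IsHermiteBiehler (fun z : ℂ =>
      confluentHypergeometric ((γ : ℂ) + Complex.I * (τ : ℂ)) (2 * (γ : ℂ) + 1) (Complex.I * z)
        * Complex.exp (-(Complex.I * z) / 2)) := by
  set a : ℂ := (γ : ℂ) + Complex.I * (τ : ℂ) with ha
  set c : ℂ := 2 * (γ : ℂ) + 1 with hcdef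
  have hc : ∀ n : ℕ, c + n ≠ 0 := by
    intro n h
    have h' := congrArg Complex.re h
    simp [hcdef] at h'
    have : (0 : ℝ) ≤ n := n.cast_nonneg
    linarith
  have hconj : starRingEnd ℂ a = c - (a + 1) := by
    simp [ha, hcdef]
    ring
  have hlt : ∀ z : ℂ, 0 < z.im → ‖confluentHypergeometric (a + 1) c (Complex.I * z)‖ <
      ‖confluentHypergeometric a c (Complex.I * z)‖ := fun z hz =>
    norm_confluentHypergeometric_add_one_lt hc (by rw [hconj]; ring) (by simpa [ha] using hγ)
      (by simpa using hz)
  refine ⟨?_, fun z hz => ?_, fun z hz => ?_⟩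
  · have := differentiable_confluentHypergeometric hc a
    fun_prop
  · exact mul_ne_zero (norm_pos_iff.1 ((norm_nonneg _).trans_lt (hlt z hz)))
      (Complex.exp_ne_zero _)
  · -- Kummer's transformation identifies `conj (E(z̄))` with the function of parameter `a + 1`.
    have hE : starRingEnd ℂ (confluentHypergeometric a c (Complex.I * starRingEnd ℂ z)
        * Complex.exp (-(Complex.I * starRingEnd ℂ z) / 2)) =
        confluentHypergeometric (a + 1) c (Complex.I * z) * Complex.exp (-(Complex.I * z) / 2) := by
      have hk := confluentHypergeometric_sub_eq_exp_mul hc (a + 1) (-(Complex.I * z))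
      have hcc : starRingEnd ℂ c = c := by simp [hcdef, map_ofNat]
      rw [map_mul, conj_confluentHypergeometric, ← Complex.exp_conj, hcc, hconj]
      simp only [map_mul, map_neg, map_div₀, Complex.conj_I, Complex.conj_conj, map_ofNat, neg_mul,
        neg_neg]
      rw [hk, neg_neg, mul_assoc, ← Complex.exp_add]
      ring_nf
    rw [← Complex.norm_conj, hE, norm_mul, norm_mul]
    gcongr
    exact (hlt z hz).le
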